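/- Let $V=\{x\in\mathbb Z^2 : \gcd(x_1,x_2)=1\}$ be the set of visible points of the square lattice. Identify subsets of $\mathbb Z^2$ with elements of $\{0,1\}^{\mathbb Z^2}$ (product topology), and let $\mathbb X_V=\overline{\{t+V : t\in\mathbb Z^2\}}$, on which $\mathbb Z^2$ acts by translation. For $\rho>0$, let $B_\rho(0)$ be the closed Euclidean disc of radius $\rho$ around $0$. The $\rho$-patch of $X\subseteq\mathbb Z^2$ at $t\in\mathbb Z^2$ is $(X-t)\cap B_\rho(0)$, and for a $\rho$-patch $\mathcal P$ of $V$ let $C_{\mathcal P}$ be the set of all $X\in\mathbb X_V$ whose $\rho$-patch at $0$ is $\mathcal P$. **Theorem.** There is exactly one Borel probability measure $\nu$ on $\mathbb X_V$ such that, for every $\rho>0$ and every $\rho$-patch $\mathcal P$ of $V$, the limit on the right-hand side below exists and $$\nu(C_{\mathcal P})=\lim_{R\to\infty}\frac{1}{\pi R^2}\,\bigl|\{t\in\mathbb Z^2\cap B_R(0) : (V-t)\cap B_\rho(0)=\mathcal P\}\bigr| .$$ This measure $\nu$ is invariant under the translation action of $\mathbb Z^2$ on $\mathbb X_V$, and it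 is ergodic for this action: every Borel set $E\subseteq\mathbb X_V$ with $\nu\bigl((t+E)\,\triangle\,E\bigr)=0$ for all $t\in\mathbb Z^2$ satisfies $\nu(E)\in\{0,1\}$. -/

import Mathlib

open MeasureTheory Filter Topology

namespace VisiblePoints

/-- A configuration on `ℤ²`: the subset `X ⊆ ℤ²` is encoded by its indicator `x ↦ X x`. The space
carries the product of the discrete topologies on `Bool` and the corresponding Borel σ-algebra. -/
abbrev Config : Type := ℤ × ℤ → Bool

/-- The visible points of `ℤ²`: the points with coprime coordinates. -/
def V : Config := fun x => decide (Int.gcd x.1 x.2 = 1)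

/-- The translate `t + X`. -/
def translate (t : ℤ × ℤ) (X : Config) : Config := fun x => X (x - t)

/-- The hull of `V`: the closure of the set of all translates `t + V`, `t ∈ ℤ²`. -/
def hull : Set Config := closure (Set.range fun t : ℤ × ℤ => translate t V)

theorem continuous_translate (t : ℤ × ℤ) : Continuous (translate t) :=
  continuous_pi fun x => continuous_apply (x - t)

theorem translate_translate (s t : ℤ × ℤ) (X : Config) :
    translate s (translate t X) = translate (s + t) X := by
  funext x
  simp only [translate]
  congr 1
  abel

theorem translate_mem_hull (t : ℤ × ℤ) {X : Config} (hX : X ∈ hull) : translate t X ∈ hull := by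
  refine map_mem_closure (continuous_translate t) hX ?_
  rintro _ ⟨s, rfl⟩
  exact ⟨t + s, (translate_translate t s V).symm⟩

/-- The translation action of `ℤ²` on the hull of `V`. -/
instance instAddActionHull : AddAction (ℤ × ℤ) hull where
  vadd t X := ⟨translate t X.1, translate_mem_hull t X.2⟩
  zero_vadd X := Subtype.ext (funext fun x => congrArg X.1 (sub_zero x))
  add_vadd s t X := Subtype.ext (translate_translate s t X.1).symm

/-- The points of `ℤ²` in the closed Euclidean disc of radius `ρ ≥ 0` around the origin. -/
def ball (ρ : ℝ) : Set (ℤ × ℤ) := {x | (x.1 : ℝ) ^ 2 + (x.2 : ℝ) ^ 2 ≤ ρ ^ 2}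

theorem ball_finite (ρ : ℝ) : (ball ρ).Finite := by
  refine (Set.finite_Icc ((-⌈|ρ|⌉, -⌈|ρ|⌉) : ℤ × ℤ) (⌈|ρ|⌉, ⌈|ρ|⌉)).subset ?_
  rintro ⟨a, b⟩ h
  have h' : (a : ℝ) ^ 2 + (b : ℝ) ^ 2 ≤ ρ ^ 2 := h
  have ha : |(a : ℝ)| ≤ |ρ| := sq_le_sq.mp (by nlinarith [sq_nonneg (b : ℝ)])
  have hb : |(b : ℝ)| ≤ |ρ| := sq_le_sq.mp (by nlinarith [sq_nonneg (a : ℝ)])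
  have hc : |ρ| ≤ (⌈|ρ|⌉ : ℝ) := Int.le_ceil _
  obtain ⟨ha1, ha2⟩ := abs_le.mp (ha.trans hc)
  obtain ⟨hb1, hb2⟩ := abs_le.mp (hb.trans hc)
  exact ⟨⟨by exact_mod_cast ha1, by exact_mod_cast hb1⟩,
    ⟨by exact_mod_cast ha2, by exact_mod_cast hb2⟩⟩

/-- The natural density of `S ⊆ ℤ²` exists and equals `d`. -/
def HasDensity (S : Set (ℤ × ℤ)) (d : ℝ) : Prop :=
  Tendsto (fun R : ℝ => ((S ∩ ball R).ncard : ℝ) / (Real.pi * R ^ 2)) atTop (𝓝 d)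

/-- The `ρ`-patch `(X - t) ∩ B_ρ(0)` of the configuration `X` at `t`. -/
def patch (ρ : ℝ) (X : Config) (t : ℤ × ℤ) : Set (ℤ × ℤ) := {x | x ∈ ball ρ ∧ X (x + t) = true}

/-- The set of all `ρ`-patches of the visible points. -/
def patches (ρ : ℝ) : Set (Set (ℤ × ℤ)) := Set.range (patch ρ V)

/-- The cylinder set of all elements of the hull whose `ρ`-patch at `0` is `P`. -/
def patchCylinder (ρ : ℝ) (P : Set (ℤ × ℤ)) : Set hull := {X | patch ρ X.1 0 = P}

/-- `ν` is a Borel probability measure on the hull that gives each cylinder set `C_P`, for `P` a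
`ρ`-patch of `V`, the frequency of `P` in `V`, i.e. the natural density (which is thereby
required to exist) of the set of all `t ∈ ℤ²` such that the `ρ`-patch of `V` at `t` is `P`. -/
structure IsPatchFrequencyMeasure (ν : Measure hull) : Prop where
  isProbabilityMeasure : IsProbabilityMeasure ν
  hasDensity : ∀ ρ : ℝ, 0 < ρ → ∀ P ∈ patches ρ,
    HasDensity {t | patch ρ V t = P} (ν.real (patchCylinder ρ P))

end VisiblePoints

open scoped Pointwise

namespace VisiblePoints

/-! A point is visible exactly when it is nonzero modulo every prime, so `V - t` is the value of
`sieve` at the image `diag t` of `t` in the compact group `∏ₚ (ℤ/pℤ)²`. The measure sought is the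
image of Haar measure under `sieve`, and its properties are transported from the group.

Frequencies (`hasDensity_patch`): conditions modulo finitely many primes are equidistributed along
`diag` by the Chinese remainder theorem (`hasDensity_of_dependsOn`). Since `sieve` involves all
primes and is not continuous, this alone does not suffice; but primes `≥ N` affect a patch only on a
set whose Haar measure and upper density are both at most a constant times `∑_{n ≥ N} 1 / n²`, and
`HasDensity.of_approx` passes to the limit.

A patch absent from `V` has frequency zero, so the image measure is carried by the hull
(`ae_sieve_mem_hull`). Uniqueness holds because the patch cylinders, up to the empty set, are stable
under intersection and generate the Borel sets. Translating configurations corresponds to rotating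
the group by elements of the dense subgroup `diag ℤ²`, so invariance and ergodicity come from Haar
measure (`ergodicVAdd_patchFrequencyMeasure`). -/

/-! ### Discs and natural density -/

theorem add_mem_ball {ρ R : ℝ} (hρ : 0 ≤ ρ) (hR : 0 ≤ R) {x t : ℤ × ℤ} (hx : x ∈ ball ρ)
    (ht : t ∈ ball R) : x + t ∈ ball (ρ + R) := by
  have hx' : (x.1 : ℝ) ^ 2 + (x.2 : ℝ) ^ 2 ≤ ρ ^ 2 := hx
  have ht' : (t.1 : ℝ) ^ 2 + (t.2 : ℝ) ^ 2 ≤ R ^ 2 := ht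
  have h : ((x.1 : ℝ) * t.1 + x.2 * t.2) ≤ ρ * R := by
    refine abs_le_of_sq_le_sq' ?_ (mul_nonneg hρ hR) |>.2
    calc ((x.1 : ℝ) * t.1 + x.2 * t.2) ^ 2
        ≤ ((x.1 : ℝ) ^ 2 + (x.2 : ℝ) ^ 2) * ((t.1 : ℝ) ^ 2 + (t.2 : ℝ) ^ 2) := by
          -- Lagrange's identity: the two sides differ by exactly this square.
          nlinarith [sq_nonneg ((x.1 : ℝ) * t.2 - x.2 * t.1)]
      _ ≤ ρ ^ 2 * R ^ 2 := by gcongr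
      _ = (ρ * R) ^ 2 := by ring
  change ((x.1 + t.1 : ℤ) : ℝ) ^ 2 + ((x.2 + t.2 : ℤ) : ℝ) ^ 2 ≤ (ρ + R) ^ 2
  push_cast
  nlinarith

theorem exists_mem_ball (x : ℤ × ℤ) : ∃ n : ℕ, 0 < n ∧ x ∈ ball n := by
  refine ⟨x.1.natAbs + x.2.natAbs + 1, by omega, ?_⟩
  change (x.1 : ℝ) ^ 2 + (x.2 : ℝ) ^ 2 ≤ _
  have h1 : (x.1 : ℝ) ^ 2 = (x.1.natAbs : ℝ) ^ 2 := by
    rw [Nat.cast_natAbs, Int.cast_abs, sq_abs]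
  have h2 : (x.2 : ℝ) ^ 2 = (x.2.natAbs : ℝ) ^ 2 := by
    rw [Nat.cast_natAbs, Int.cast_abs, sq_abs]
  rw [h1, h2]
  push_cast
  have := Nat.cast_nonneg (α := ℝ) x.1.natAbs
  have := Nat.cast_nonneg (α := ℝ) x.2.natAbs
  nlinarith

theorem ball_mono {r R : ℝ} (hr : 0 ≤ r) (h : r ≤ R) : ball r ⊆ ball R :=
  fun _ hx => le_trans hx (pow_le_pow_left₀ hr h 2)

theorem inter_ball_finite (S : Set (ℤ × ℤ)) (R : ℝ) : (S ∩ ball R).Finite :=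
  (ball_finite R).subset Set.inter_subset_right

theorem volume_real_unitDisc :
    volume.real {x : Fin 2 → ℝ | x 0 ^ 2 + x 1 ^ 2 ≤ 1} = Real.pi := by
  have h := (EuclideanSpace.volume_preserving_symm_measurableEquiv_toLp (Fin 2)).symm
  have h2 := h.measure_preimage_equiv (Metric.closedBall (0 : EuclideanSpace ℝ (Fin 2)) 1)
  have h3 := EuclideanSpace.volume_closedBall_fin_two (0 : EuclideanSpace ℝ (Fin 2)) 1
  have h4 : {x : Fin 2 → ℝ | x 0 ^ 2 + x 1 ^ 2 ≤ 1} =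
      (MeasurableEquiv.toLp 2 (Fin 2 → ℝ)) ⁻¹'
        (Metric.closedBall (0 : EuclideanSpace ℝ (Fin 2)) 1) := by
    ext x
    simp [EuclideanSpace.norm_eq, Fin.sum_univ_two]
  rw [Measure.real, h4]
  erw [h2, h3]
  simp [Real.pi_nonneg]

/-- Gauss's lattice point count: the points of `R⁻¹ ℤ²` in the unit disc number asymptotically `π
R²`, the boundary being null by convexity. -/
theorem hasDensity_univ : HasDensity Set.univ 1 := by
  set s : Set (Fin 2 → ℝ) := {x | x 0 ^ 2 + x 1 ^ 2 ≤ 1} with hs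
  have hclosed : IsClosed s := isClosed_le (by fun_prop) (by fun_prop)
  have hconv : Convex ℝ s := by
    have h0 : ConvexOn ℝ Set.univ fun x : Fin 2 → ℝ => x 0 ^ 2 :=
      (even_two.convexOn_pow (𝕜 := ℝ)).comp_linearMap
        (LinearMap.proj 0 : (Fin 2 → ℝ) →ₗ[ℝ] ℝ)
    have h1 : ConvexOn ℝ Set.univ fun x : Fin 2 → ℝ => x 1 ^ 2 :=
      (even_two.convexOn_pow (𝕜 := ℝ)).comp_linearMap
        (LinearMap.proj 1 : (Fin 2 → ℝ) →ₗ[ℝ] ℝ)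
    simpa using (h0.add h1).convex_le 1
  have hbdd : Bornology.IsBounded s := by
    refine (Metric.isBounded_closedBall (x := (0 : Fin 2 → ℝ)) (r := 1)).subset fun x hx => ?_
    have hx' : x 0 ^ 2 + x 1 ^ 2 ≤ 1 := hx
    rw [mem_closedBall_zero_iff, pi_norm_le_iff_of_nonneg zero_le_one]
    intro i
    rw [Real.norm_eq_abs]
    refine abs_le_one_iff_mul_self_le_one.2 ?_
    fin_cases i <;> simp <;> nlinarith [sq_nonneg (x 0), sq_nonneg (x 1)]
  have key := tendsto_card_div_pow_atTop_volume' s hbdd hclosed.measurableSet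
    (hconv.addHaar_frontier volume) (by
      -- The disc is star-shaped about `0`, so its dilates are nested; this lets the scale be real
      -- rather than integral.
      intro x y hx hxy
      have hz : (0 : Fin 2 → ℝ) ∈ s := by simp [hs]
      rintro _ ⟨v, hv, rfl⟩
      refine ⟨(x / y) • v, ?_, ?_⟩
      · exact hconv.smul_mem_of_zero_mem hz hv
          ⟨div_nonneg hx.le (hx.le.trans hxy), div_le_one_of_le₀ hxy (hx.le.trans hxy)⟩
      · have : y ≠ 0 := (hx.trans_le hxy).ne'
        simp [smul_smul, mul_div_cancel₀ _ this])
  rw [volume_real_unitDisc] at key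
  have key' := key.div_const Real.pi
  rw [div_self Real.pi_ne_zero] at key'
  refine key'.congr' ?_
  filter_upwards [eventually_gt_atTop 0] with R hR
  have hcard : Nat.card ↑(s ∩ R⁻¹ • ((Submodule.span ℤ (Set.range (Pi.basisFun ℝ (Fin 2))) :
      Submodule ℤ (Fin 2 → ℝ)) : Set (Fin 2 → ℝ))) = (Set.univ ∩ ball R : Set (ℤ × ℤ)).ncard := by
    rw [Nat.card_coe_set_eq]
    symm
    refine Set.ncard_congr (fun t _ => R⁻¹ • ![(t.1 : ℝ), (t.2 : ℝ)]) ?_ ?_ ?_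
    · rintro t ⟨-, ht⟩
      refine ⟨?_, Set.smul_mem_smul_set ?_⟩
      · have ht' : (t.1 : ℝ) ^ 2 + (t.2 : ℝ) ^ 2 ≤ R ^ 2 := ht
        simp only [hs, Set.mem_ofPred_eq, Pi.smul_apply, smul_eq_mul, Matrix.cons_val_zero,
          Matrix.cons_val_one]
        rw [mul_pow, mul_pow, ← mul_add, inv_pow]
        exact inv_mul_le_one_of_le₀ ht' (by positivity)
      · rw [SetLike.mem_coe, Module.Basis.mem_span_iff_repr_mem]
        intro i
        fin_cases i
        · exact ⟨t.1, by simp⟩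
        · exact ⟨t.2, by simp⟩
    · intro t u _ _ h
      have h' := smul_right_injective _ (inv_ne_zero hR.ne') h
      have e0 := congrFun h' 0
      have e1 := congrFun h' 1
      simp at e0 e1
      exact Prod.ext e0 e1
    · rintro _ ⟨hv, w, hw, rfl⟩
      rw [SetLike.mem_coe, Module.Basis.mem_span_iff_repr_mem] at hw
      obtain ⟨a, ha⟩ := hw 0
      obtain ⟨b, hb⟩ := hw 1
      simp at ha hb
      have hw' : w = ![(a : ℝ), (b : ℝ)] := by
        ext i; fin_cases i <;> simp [ha, hb]
      refine ⟨(a, b), ⟨trivial, ?_⟩, by simp [hw']⟩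
      change (a : ℝ) ^ 2 + (b : ℝ) ^ 2 ≤ R ^ 2
      simp only [hs, hw', Set.mem_ofPred_eq, Pi.smul_apply, smul_eq_mul, Matrix.cons_val_zero,
          Matrix.cons_val_one] at hv
      rw [mul_pow, mul_pow, ← mul_add, inv_pow] at hv
      rwa [inv_mul_le_one₀ (by positivity)] at hv
  rw [hcard, Fintype.card_fin, div_div, mul_comm]

theorem HasDensity.tendsto_add {S : Set (ℤ × ℤ)} {d : ℝ} (h : HasDensity S d) (c : ℝ) :
    Tendsto (fun R : ℝ => ((S ∩ ball (R + c)).ncard : ℝ) / (Real.pi * R ^ 2)) atTop (𝓝 d) := by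
  have h1 : Tendsto (fun R : ℝ => R + c) atTop atTop := tendsto_atTop_add_const_right _ _ tendsto_id
  have h2 : Tendsto (fun R : ℝ => (1 + c / R) ^ 2) atTop (𝓝 1) := by
    have : Tendsto (fun R : ℝ => c / R) atTop (𝓝 0) := tendsto_const_nhds.div_atTop tendsto_id
    simpa using (this.const_add 1).pow 2
  have h3 := (h.comp h1).mul h2
  rw [mul_one] at h3
  refine h3.congr' ?_
  filter_upwards [eventually_gt_atTop 0, eventually_gt_atTop (-c)] with R hR hc
  have : R + c ≠ 0 := by linarith
  have := Real.pi_ne_zero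
  simp only [Function.comp_apply]
  field_simp

/-- Shifting by `a` with `|a| ≤ n` squeezes the count between those of `S` in the discs of radii `R
- n` and `R + n`, whose areas are asymptotically equal. -/
theorem HasDensity.translate {S : Set (ℤ × ℤ)} {d : ℝ} (h : HasDensity S d) (a : ℤ × ℤ) :
    HasDensity {t | t - a ∈ S} d := by
  obtain ⟨n, -, hn⟩ := exists_mem_ball a
  have hn' : -a ∈ ball n := by
    have h : (a.1 : ℝ) ^ 2 + (a.2 : ℝ) ^ 2 ≤ (n : ℝ) ^ 2 := hn
    change ((-a.1 : ℤ) : ℝ) ^ 2 + ((-a.2 : ℤ) : ℝ) ^ 2 ≤ (n : ℝ) ^ 2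
    push_cast
    linarith
  have hn0 : (0 : ℝ) ≤ n := Nat.cast_nonneg n
  refine tendsto_of_tendsto_of_tendsto_of_le_of_le' (h.tendsto_add (-(n : ℝ))) (h.tendsto_add n) ?_ ?_
  · filter_upwards [eventually_gt_atTop (n : ℝ)] with R hR
    gcongr ?_ / _
    refine Nat.cast_le.2 (Set.ncard_le_ncard_of_injOn (fun t => a + t) ?_ (add_right_injective a).injOn
      (inter_ball_finite _ _))
    rintro t ⟨ht, htR⟩
    refine ⟨by simpa using ht, ?_⟩
    have := add_mem_ball hn0 (by linarith) hn htR
    simpa using this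
  · filter_upwards [eventually_gt_atTop 0] with R hR
    gcongr ?_ / _
    refine Nat.cast_le.2 (Set.ncard_le_ncard_of_injOn (fun t => -a + t) ?_ (add_right_injective _).injOn
      (inter_ball_finite _ _))
    rintro t ⟨ht, htR⟩
    refine ⟨by simpa [sub_eq_neg_add] using ht, ?_⟩
    have := add_mem_ball hn0 hR.le hn' htR
    rwa [add_comm (n : ℝ)] at this

theorem ncard_multiples_inter_ball (M : ℕ) (hM : 0 < M) (R : ℝ) :
    ({t : ℤ × ℤ | (M : ℤ) ∣ t.1 ∧ (M : ℤ) ∣ t.2} ∩ ball R).ncard = (ball (R / M)).ncard := by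
  have hM' : (0 : ℝ) < M := Nat.cast_pos.2 hM
  symm
  refine Set.ncard_congr (fun t _ => ((M : ℤ) * t.1, (M : ℤ) * t.2)) ?_ ?_ ?_
  · intro t ht
    refine ⟨⟨Dvd.intro _ rfl, Dvd.intro _ rfl⟩, ?_⟩
    have ht' : (t.1 : ℝ) ^ 2 + (t.2 : ℝ) ^ 2 ≤ (R / M) ^ 2 := ht
    rw [div_pow, le_div_iff₀ (by positivity)] at ht'
    change (((M : ℤ) * t.1 : ℤ) : ℝ) ^ 2 + (((M : ℤ) * t.2 : ℤ) : ℝ) ^ 2 ≤ R ^ 2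
    push_cast
    linarith
  · intro t u _ _ h
    have hM0 : (M : ℤ) ≠ 0 := by exact_mod_cast hM.ne'
    simp only [Prod.mk.injEq, mul_right_inj' hM0] at h
    exact Prod.ext h.1 h.2
  · rintro ⟨_, _⟩ ⟨⟨⟨a, rfl⟩, ⟨b, rfl⟩⟩, h⟩
    refine ⟨(a, b), ?_, rfl⟩
    have h' : (((M : ℤ) * a : ℤ) : ℝ) ^ 2 + (((M : ℤ) * b : ℤ) : ℝ) ^ 2 ≤ R ^ 2 := h
    push_cast at h'
    change (a : ℝ) ^ 2 + (b : ℝ) ^ 2 ≤ (R / M) ^ 2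
    rw [div_pow, le_div_iff₀ (by positivity)]
    linarith

theorem hasDensity_multiples (M : ℕ) (hM : 0 < M) :
    HasDensity {t : ℤ × ℤ | (M : ℤ) ∣ t.1 ∧ (M : ℤ) ∣ t.2} (1 / (M : ℝ) ^ 2) := by
  have hM' : (0 : ℝ) < M := Nat.cast_pos.2 hM
  have h := (hasDensity_univ.comp (tendsto_id.atTop_div_const hM')).div_const ((M : ℝ) ^ 2)
  refine h.congr' ?_
  filter_upwards [eventually_gt_atTop 0] with R hR
  have := Real.pi_ne_zero
  simp only [Function.comp_apply, Set.univ_inter, id, ncard_multiples_inter_ball M hM]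
  field_simp

theorem hasDensity_empty : HasDensity ∅ 0 := by
  simp [HasDensity]

theorem HasDensity.union {S T : Set (ℤ × ℤ)} {d e : ℝ} (hS : HasDensity S d) (hT : HasDensity T e)
    (h : Disjoint S T) : HasDensity (S ∪ T) (d + e) := by
  refine (Tendsto.add hS hT).congr fun R => ?_
  rw [Set.union_inter_distrib_right, Set.ncard_union_eq
    (h.mono Set.inter_subset_left Set.inter_subset_left) (inter_ball_finite _ _)
    (inter_ball_finite _ _), Nat.cast_add, add_div]

theorem HasDensity.biUnion {ι : Type*} (s : Finset ι) {S : ι → Set (ℤ × ℤ)} {d : ι → ℝ}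
    (hS : ∀ i ∈ s, HasDensity (S i) (d i)) (h : (s : Set ι).PairwiseDisjoint S) :
    HasDensity (⋃ i ∈ s, S i) (∑ i ∈ s, d i) := by
  classical
  induction s using Finset.induction_on with
  | empty => simpa using hasDensity_empty
  | insert a s ha ih =>
    rw [Finset.set_biUnion_insert, Finset.sum_insert ha]
    refine (hS a (by simp)).union (ih (fun i hi => hS i (by simp [hi]))
      (h.subset (by simp))) ?_
    rw [Set.disjoint_iUnion₂_right]
    intro i hi
    exact h (by simp) (by simp [hi]) (by rintro rfl; exact ha hi)

theorem HasDensity.unique {S : Set (ℤ × ℤ)} {d e : ℝ} (h : HasDensity S d) (h' : HasDensity S e) :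
    d = e := tendsto_nhds_unique h h'

/-- A set that differs from sets with a density by sets of arbitrarily small upper density has the
limiting density. -/
theorem HasDensity.of_approx {S : Set (ℤ × ℤ)} {d : ℝ}
    (h : ∀ ε > 0, ∃ (T B : Set (ℤ × ℤ)) (e : ℝ), HasDensity T e ∧ |e - d| ≤ ε ∧
      (∀ t ∉ B, t ∈ S ↔ t ∈ T) ∧
      ∀ᶠ R : ℝ in atTop, ((B ∩ ball R).ncard : ℝ) / (Real.pi * R ^ 2) ≤ ε) :
    HasDensity S d := by
  rw [HasDensity, Metric.tendsto_nhds]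
  intro ε hε
  obtain ⟨T, B, e, hT, hed, hB, hBR⟩ := h (ε / 4) (by positivity)
  filter_upwards [hBR, (Metric.tendsto_nhds.1 hT) (ε / 4) (by positivity), eventually_gt_atTop 0]
    with R h1 h2 hR
  have hpos : 0 < Real.pi * R ^ 2 := by positivity
  have a1 : ((S ∩ ball R).ncard : ℝ) ≤ (T ∩ ball R).ncard + (B ∩ ball R).ncard := by
    norm_cast
    refine (Set.ncard_le_ncard ?_ ((inter_ball_finite T R).union (inter_ball_finite B R))).trans
      (Set.ncard_union_le _ _)
    rintro t ⟨ht, htR⟩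
    by_cases hb : t ∈ B
    · exact Or.inr ⟨hb, htR⟩
    · exact Or.inl ⟨(hB t hb).1 ht, htR⟩
  have a2 : ((T ∩ ball R).ncard : ℝ) ≤ (S ∩ ball R).ncard + (B ∩ ball R).ncard := by
    norm_cast
    refine (Set.ncard_le_ncard ?_ ((inter_ball_finite S R).union (inter_ball_finite B R))).trans
      (Set.ncard_union_le _ _)
    rintro t ⟨ht, htR⟩
    by_cases hb : t ∈ B
    · exact Or.inr ⟨hb, htR⟩
    · exact Or.inl ⟨(hB t hb).2 ht, htR⟩
  have b1 := div_le_div_of_nonneg_right a1 hpos.le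
  have b2 := div_le_div_of_nonneg_right a2 hpos.le
  rw [add_div] at b1 b2
  rw [Real.dist_eq, abs_lt] at *
  rw [abs_le] at hed
  constructor <;> linarith [hed.1, hed.2, h2.1, h2.2]

/-! ### Lattice points divisible by a large integer -/

/-- Excluding the origin matters: the box of side `2k + 1` has `4k² + 4k ≤ 8k²` nonzero points, so
no constant term appears and the bounds can be summed over `d`. -/
theorem ncard_nonzero_multiples_le {d : ℕ} (hd : 0 < d) {R : ℝ} (hR : 0 ≤ R) :
    (({t : ℤ × ℤ | t ≠ 0 ∧ (d : ℤ) ∣ t.1 ∧ (d : ℤ) ∣ t.2} ∩ ball R).ncard : ℝ)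
      ≤ 8 * R ^ 2 * (1 / (d : ℝ) ^ 2) := by
  have hd' : (0 : ℝ) < d := Nat.cast_pos.2 hd
  set k := ⌊R / d⌋₊ with hk
  have hkR : (k : ℝ) ≤ R / d := Nat.floor_le (by positivity)
  let F : Finset (ℤ × ℤ) := (Finset.Icc (-k : ℤ) k ×ˢ Finset.Icc (-k : ℤ) k).erase 0
  have hF : (F.card : ℝ) ≤ 8 * (k : ℝ) ^ 2 := by
    have : F.card = (2 * k + 1) * (2 * k + 1) - 1 := by
      rw [Finset.card_erase_of_mem (by simp), Finset.card_product, Int.card_Icc]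
      congr 2 <;> omega
    rw [this]
    have h2 : (2 * k + 1) * (2 * k + 1) - 1 ≤ 8 * k ^ 2 := by
      rw [Nat.sub_le_iff_le_add]
      nlinarith [Nat.le_mul_self k]
    exact_mod_cast h2
  have hle : ({t : ℤ × ℤ | t ≠ 0 ∧ (d : ℤ) ∣ t.1 ∧ (d : ℤ) ∣ t.2} ∩ ball R).ncard ≤ F.card := by
    rw [← Set.ncard_coe_finset]
    refine (Set.ncard_le_ncard (t := (fun t : ℤ × ℤ => ((d : ℤ) * t.1, (d : ℤ) * t.2)) '' F)
      ?_ (F.finite_toSet.image _)).trans (Set.ncard_image_le F.finite_toSet)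
    rintro ⟨_, _⟩ ⟨⟨h0, ⟨a, rfl⟩, ⟨b, rfl⟩⟩, h⟩
    refine ⟨(a, b), ?_, rfl⟩
    have h' : (((d : ℤ) * a : ℤ) : ℝ) ^ 2 + (((d : ℤ) * b : ℤ) : ℝ) ^ 2 ≤ R ^ 2 := h
    push_cast at h'
    have ha : a.natAbs ≤ k := by
      refine Nat.le_floor ?_
      rw [le_div_iff₀ hd', Nat.cast_natAbs, Int.cast_abs]
      refine le_of_sq_le_sq ?_ hR
      rw [mul_pow, sq_abs]
      nlinarith [sq_nonneg ((d : ℝ) * b)]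
    have hb : b.natAbs ≤ k := by
      refine Nat.le_floor ?_
      rw [le_div_iff₀ hd', Nat.cast_natAbs, Int.cast_abs]
      refine le_of_sq_le_sq ?_ hR
      rw [mul_pow, sq_abs]
      nlinarith [sq_nonneg ((d : ℝ) * a)]
    simp only [F, Finset.coe_erase, Set.mem_sdiff, Finset.mem_coe, Finset.mem_product,
      Finset.mem_Icc, Set.mem_singleton_iff]
    refine ⟨⟨by omega, by omega⟩, ?_⟩
    rintro h1
    rw [Prod.mk_eq_zero] at h1
    exact h0 (by simp [h1.1, h1.2])
  calc _ ≤ (F.card : ℝ) := by exact_mod_cast hle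
    _ ≤ 8 * (k : ℝ) ^ 2 := hF
    _ ≤ 8 * (R / d) ^ 2 := by gcongr
    _ = _ := by ring

/-- The tail `∑_{n ≥ N} 1 / n²` of the series of inverse squares. -/
noncomputable def invSqTail (N : ℕ) : ℝ := ∑' n : ℕ, 1 / ((n + N : ℕ) : ℝ) ^ 2

theorem summable_invSq (N : ℕ) : Summable fun n : ℕ => 1 / ((n + N : ℕ) : ℝ) ^ 2 :=
  (summable_nat_add_iff N (f := fun n : ℕ => 1 / (n : ℝ) ^ 2)).2
    (Real.summable_one_div_nat_pow.2 one_lt_two)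

theorem tendsto_invSqTail : Tendsto invSqTail atTop (𝓝 0) :=
  tendsto_sum_nat_add fun n : ℕ => 1 / (n : ℝ) ^ 2

theorem invSqTail_nonneg (N : ℕ) : 0 ≤ invSqTail N := tsum_nonneg fun _ => by positivity

/-- A union bound over `d`. The summand `1` pays for the origin, which every `d` divides. -/
theorem ncard_large_multiples_le {N : ℕ} (hN : 0 < N) {R : ℝ} (hR : 0 ≤ R) :
    (({t : ℤ × ℤ | ∃ d : ℕ, N ≤ d ∧ (d : ℤ) ∣ t.1 ∧ (d : ℤ) ∣ t.2} ∩ ball R).ncard : ℝ)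
      ≤ 1 + 8 * R ^ 2 * invSqTail N := by
  set A : ℕ → Set (ℤ × ℤ) := fun n =>
    {t : ℤ × ℤ | t ≠ 0 ∧ ((n + N : ℕ) : ℤ) ∣ t.1 ∧ ((n + N : ℕ) : ℤ) ∣ t.2} ∩ ball R with hA
  -- A divisor of both coordinates of a nonzero point of the disc is at most `⌊R⌋₊`, so finitely
  -- many `d` suffice.
  set K := ⌊R⌋₊ + 1 with hK
  have hsub : {t : ℤ × ℤ | ∃ d : ℕ, N ≤ d ∧ (d : ℤ) ∣ t.1 ∧ (d : ℤ) ∣ t.2} ∩ ball R ⊆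
      {0} ∪ ⋃ n ∈ Finset.range K, A n := by
    rintro t ⟨⟨d, hd, h1, h2⟩, ht⟩
    by_cases h0 : t = 0
    · exact Or.inl h0
    right
    have ht' : (t.1 : ℝ) ^ 2 + (t.2 : ℝ) ^ 2 ≤ R ^ 2 := ht
    have aux : ∀ a : ℤ, a ≠ 0 → (d : ℤ) ∣ a → (a : ℝ) ^ 2 ≤ R ^ 2 → d ≤ ⌊R⌋₊ := by
      intro a ha hda haR
      have h3 : d ≤ a.natAbs := Nat.le_of_dvd (Int.natAbs_pos.2 ha) (Int.natCast_dvd.1 hda)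
      refine h3.trans (Nat.le_floor ?_)
      rw [Nat.cast_natAbs, Int.cast_abs]
      exact le_of_sq_le_sq (by rwa [sq_abs]) hR
    have hdR : d ≤ ⌊R⌋₊ := by
      by_cases h3 : t.1 = 0
      · refine aux t.2 (fun h4 => h0 (Prod.ext h3 h4)) h2 (by nlinarith [sq_nonneg (t.1 : ℝ)])
      · exact aux t.1 h3 h1 (by nlinarith [sq_nonneg (t.2 : ℝ)])
    simp only [Set.mem_iUnion, Finset.mem_range]
    refine ⟨d - N, by omega, ⟨h0, ?_, ?_⟩, ht⟩ <;> rwa [Nat.sub_add_cancel hd]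
  have hfin : (⋃ n ∈ Finset.range K, A n).Finite :=
    (Finset.range K).finite_toSet.biUnion fun n _ => inter_ball_finite _ _
  have h1 : ({t : ℤ × ℤ | ∃ d : ℕ, N ≤ d ∧ (d : ℤ) ∣ t.1 ∧ (d : ℤ) ∣ t.2} ∩ ball R).ncard ≤
      1 + ∑ n ∈ Finset.range K, (A n).ncard := by
    refine (Set.ncard_le_ncard hsub ((Set.finite_singleton 0).union hfin)).trans
      ((Set.ncard_union_le _ _).trans ?_)
    rw [Set.ncard_singleton]
    gcongr
    exact Finset.set_ncard_biUnion_le _ _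
  calc _ ≤ ((1 + ∑ n ∈ Finset.range K, (A n).ncard : ℕ) : ℝ) := by exact_mod_cast h1
    _ ≤ 1 + ∑ n ∈ Finset.range K, 8 * R ^ 2 * (1 / ((n + N : ℕ) : ℝ) ^ 2) := by
      push_cast
      gcongr with n
      exact_mod_cast ncard_nonzero_multiples_le (d := n + N) (by omega) hR
    _ ≤ _ := by
      rw [← Finset.mul_sum]
      gcongr
      exact (summable_invSq N).sum_le_tsum _ fun _ _ => by positivity

/-! ### Haar measure on the residues and equidistribution of `ℤ²` -/

instance (p : Nat.Primes) : NeZero (p : ℕ) := ⟨p.2.ne_zero⟩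

/-- The compact group `∏ₚ (ℤ/pℤ)²`. -/
abbrev Residues : Type := ∀ p : Nat.Primes, ZMod p × ZMod p

/-- The uniform probability measure on `(ℤ/nℤ)²`. -/
noncomputable def uniform (n : ℕ) : Measure (ZMod n × ZMod n) :=
  ((n : ENNReal) ^ 2)⁻¹ • Measure.count

theorem uniform_singleton (n : ℕ) (a : ZMod n × ZMod n) :
    uniform n {a} = ((n : ENNReal) ^ 2)⁻¹ := by
  simp [uniform]

instance (p : Nat.Primes) : IsProbabilityMeasure (uniform p) := by
  constructor
  have hp : (p : ℕ) ≠ 0 := p.2.ne_zero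
  rw [uniform, Measure.smul_apply, Measure.count_apply_finite _ Set.finite_univ]
  simp only [Set.toFinite_toFinset, Set.toFinset_univ, Finset.card_univ, Fintype.card_prod,
    ZMod.card, smul_eq_mul, ← sq]
  push_cast
  exact ENNReal.inv_mul_cancel (by simp [hp]) (by simp)

instance (p : Nat.Primes) : (uniform p).IsAddLeftInvariant :=
  inferInstanceAs ((((p : ℕ) : ENNReal) ^ 2)⁻¹ •
    (Measure.count : Measure (ZMod p × ZMod p))).IsAddLeftInvariant

/-- The Haar probability measure on `∏ₚ (ℤ/pℤ)²`. -/
noncomputable def haarResidues : Measure Residues := Measure.infinitePi fun p => uniform p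

instance : IsProbabilityMeasure haarResidues :=
  inferInstanceAs (IsProbabilityMeasure (Measure.infinitePi _))

instance : haarResidues.IsAddLeftInvariant := by
  constructor
  intro g
  have h := Measure.infinitePi_map_pi (fun p : Nat.Primes => uniform p)
    (f := fun p x => g p + x) fun p => measurable_const_add (g p)
  simp only [map_add_left_eq_self] at h
  exact h

/-- The diagonal embedding of `ℤ²`. -/
def diag : ℤ × ℤ →+ Residues where
  toFun t p := ((t.1 : ZMod p), (t.2 : ZMod p))
  map_zero' := by ext <;> simp
  map_add' s t := by ext <;> simp

theorem exists_diag_eq (s : Finset Nat.Primes) (g : Residues) : ∃ t, ∀ p ∈ s, diag t p = g p := by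
  have hs : ∀ p ∈ s, (p : ℕ) ≠ 0 := fun p _ => p.2.ne_zero
  have hc : Set.Pairwise (s : Set Nat.Primes) (Function.onFun Nat.Coprime (fun p => (p : ℕ))) :=
    fun p _ q _ hpq => (Nat.coprime_primes p.2 q.2).2 fun h => hpq (Subtype.ext h)
  let a := Nat.chineseRemainderOfFinset (fun p => (g p).1.val) (fun p : Nat.Primes => (p : ℕ)) s hs hc
  let b := Nat.chineseRemainderOfFinset (fun p => (g p).2.val) (fun p : Nat.Primes => (p : ℕ)) s hs hc
  refine ⟨((a : ℕ), (b : ℕ)), fun p hp => ?_⟩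
  have ha := (ZMod.natCast_eq_natCast_iff _ _ _).2 (a.2 p hp)
  have hb := (ZMod.natCast_eq_natCast_iff _ _ _).2 (b.2 p hp)
  rw [ZMod.natCast_zmod_val] at ha hb
  ext <;> simpa [diag]

theorem diag_eq_zero_iff (s : Finset Nat.Primes) (t : ℤ × ℤ) :
    (∀ p ∈ s, diag t p = 0) ↔
      ((∏ p ∈ s, (p : ℕ) : ℕ) : ℤ) ∣ t.1 ∧ ((∏ p ∈ s, (p : ℕ) : ℕ) : ℤ) ∣ t.2 := by
  have key : ∀ a : ℤ, ((∏ p ∈ s, (p : ℕ) : ℕ) : ℤ) ∣ a ↔ ∀ p ∈ s, ((p : ℕ) : ℤ) ∣ a := by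
    intro a
    refine ⟨fun h p hp => (Int.natCast_dvd_natCast.2 (Finset.dvd_prod_of_mem _ hp)).trans h,
      fun h => ?_⟩
    push_cast
    refine Finset.prod_dvd_of_coprime (fun p _ q _ hpq => ?_) h
    exact ((Nat.coprime_primes p.2 q.2).2 fun h => hpq (Subtype.ext h)).isCoprime
  rw [key, key, ← forall₂_and]
  refine forall₂_congr fun p _ => ?_
  simp [diag, Prod.ext_iff, CharP.intCast_eq_zero_iff (ZMod (p : ℕ)) p]

theorem denseRange_diag : DenseRange diag := by
  intro g
  rw [mem_closure_iff]
  intro U hU hg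
  obtain ⟨s, u, hu, hsub⟩ := isOpen_pi_iff.1 hU g hg
  obtain ⟨t, ht⟩ := exists_diag_eq s g
  exact ⟨diag t, hsub fun p hp => by rw [ht p hp]; exact (hu p hp).2, t, rfl⟩

theorem haarResidues_real_cylinder (s : Finset Nat.Primes) (g : Residues) :
    haarResidues.real {h | ∀ p ∈ s, h p = g p} = 1 / ((∏ p ∈ s, (p : ℕ) : ℕ) : ℝ) ^ 2 := by
  have h1 : {h : Residues | ∀ p ∈ s, h p = g p} = Set.pi s fun p => {g p} := by
    ext h; simp
  rw [Measure.real, h1, haarResidues, Measure.infinitePi_pi _ fun p _ => measurableSet_singleton _]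
  simp [uniform_singleton, ENNReal.toReal_prod, Finset.prod_pow]

/-- By the Chinese remainder theorem the set is a coset of `M ℤ²`, with `M` the product of the
primes in `s`; its density `1 / M²` is the Haar measure of the cylinder. -/
theorem hasDensity_cylinder (s : Finset Nat.Primes) (g : Residues) :
    HasDensity {t | ∀ p ∈ s, diag t p = g p} (haarResidues.real {h | ∀ p ∈ s, h p = g p}) := by
  obtain ⟨a, ha⟩ := exists_diag_eq s g
  have h := (hasDensity_multiples (∏ p ∈ s, (p : ℕ))
    (Finset.prod_pos fun p _ => p.2.pos)).translate a
  rw [haarResidues_real_cylinder]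
  convert h using 1
  ext t
  rw [Set.mem_ofPred_eq, Set.mem_ofPred_eq, Set.mem_ofPred_eq, ← diag_eq_zero_iff s (t - a)]
  refine forall₂_congr fun p hp => ?_
  rw [map_sub, Pi.sub_apply, sub_eq_zero, ha p hp]

/-- Equidistribution of the diagonal copy of `ℤ²`: conditions on finitely many coordinates. -/
theorem hasDensity_of_dependsOn (s : Finset Nat.Primes) {A : Set Residues}
    (hA : ∀ g h : Residues, (∀ p ∈ s, g p = h p) → (g ∈ A ↔ h ∈ A)) :
    HasDensity {t | diag t ∈ A} (haarResidues.real A) := by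
  classical
  -- The value `0` off `s` is arbitrary, since membership in `A` ignores those coordinates; thus `A`
  -- is a finite disjoint union of cylinders.
  let ext' : (∀ p : s, ZMod p.1 × ZMod p.1) → Residues := fun f p =>
    if hp : p ∈ s then f ⟨p, hp⟩ else 0
  have hext : ∀ f (h : Residues), (∀ p ∈ s, h p = ext' f p) ↔ s.restrict h = f := by
    intro f h
    refine ⟨fun H => funext fun p => ?_, ?_⟩
    · simpa [ext'] using H p.1 p.2
    · rintro rfl p hp
      simp [ext', hp]
  let F : Finset (∀ p : s, ZMod p.1 × ZMod p.1) := Finset.univ.filter fun f => ext' f ∈ A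
  have hAF : ∀ h : Residues, h ∈ A ↔ s.restrict h ∈ F := by
    intro h
    simp only [F, Finset.mem_filter, Finset.mem_univ, true_and]
    exact hA _ _ ((hext _ _).2 rfl)
  have e1 : A = ⋃ f ∈ F, {h | ∀ p ∈ s, h p = ext' f p} := by
    ext h
    simp only [Set.mem_iUnion, Set.mem_ofPred_eq, hext, exists_prop, exists_eq_right', hAF h]
  have e2 : {t | diag t ∈ A} = ⋃ f ∈ F, {t | ∀ p ∈ s, diag t p = ext' f p} := by
    ext t
    simp only [Set.mem_iUnion, Set.mem_ofPred_eq, hext, exists_prop, exists_eq_right', hAF]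
  have hm : ∀ f, MeasurableSet {h : Residues | ∀ p ∈ s, h p = ext' f p} := by
    intro f
    have h1 : {h : Residues | ∀ p ∈ s, h p = ext' f p} = Set.pi s fun p => {ext' f p} := by
      ext h; simp
    rw [h1]
    exact MeasurableSet.pi s.countable_toSet fun p _ => measurableSet_singleton _
  rw [e2, e1, measureReal_biUnion_finset]
  · refine HasDensity.biUnion F (fun f _ => hasDensity_cylinder s _) ?_
    intro f _ f' _ hff
    refine Set.disjoint_left.2 fun t ht ht' => hff ?_
    rw [Set.mem_ofPred_eq, hext] at ht ht'
    rw [← ht, ← ht']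
  · intro f _ f' _ hff
    refine Set.disjoint_left.2 fun t ht ht' => hff ?_
    rw [Set.mem_ofPred_eq, hext] at ht ht'
    rw [← ht, ← ht']
  · exact fun f _ => hm f

/-! ### The sieve map and its truncations -/

/-- The configuration of all `x` with `x + gₚ ≠ 0` for all primes `p`. -/
noncomputable def sieve (g : Residues) : Config :=
  open Classical in fun x => decide (∀ p, diag x p + g p ≠ 0)

/-- The configuration of all `x` with `x + gₚ ≠ 0` for all primes `p < N`. -/
noncomputable def sieveBelow (N : ℕ) (g : Residues) : Config :=
  open Classical in fun x => decide (∀ p : Nat.Primes, (p : ℕ) < N → diag x p + g p ≠ 0)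

theorem sieve_diag (t x : ℤ × ℤ) : sieve (diag t) x = V (x + t) := by
  simp only [sieve, V, decide_eq_decide, ← Pi.add_apply, ← map_add]
  generalize x + t = y
  have key : ∀ p : Nat.Primes, diag y p = 0 ↔ (p : ℕ) ∣ Int.gcd y.1 y.2 := by
    intro p
    rw [Int.dvd_gcd_iff]
    simp [diag, Prod.ext_iff, CharP.intCast_eq_zero_iff (ZMod (p : ℕ)) p]
  simp only [ne_eq, key]
  rw [Nat.eq_one_iff_not_exists_prime_dvd]
  exact ⟨fun h p hp => h ⟨p, hp⟩, fun h p => h p p.2⟩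

theorem patch_sieve_diag (ρ : ℝ) (t : ℤ × ℤ) : patch ρ (sieve (diag t)) 0 = patch ρ V t := by
  simp [patch, sieve_diag]

/-- The equivariance that turns translations of configurations into group rotations. -/
theorem sieve_sub_diag (t : ℤ × ℤ) (g : Residues) :
    sieve (g - diag t) = translate t (sieve g) := by
  funext x
  simp only [sieve, translate, decide_eq_decide, map_sub, Pi.sub_apply]
  refine forall_congr' fun p => ?_
  rw [show diag x p + (g p - diag t p) = diag x p - diag t p + g p by abel]

theorem measurable_sieve : Measurable sieve := by
  refine measurable_pi_lambda _ fun x => measurable_to_bool ?_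
  have : (fun g => sieve g x) ⁻¹' {true} = ⋂ p, {g : Residues | g p ∈ {a | diag x p + a ≠ 0}} := by
    ext g
    simp [sieve]
  rw [this]
  exact MeasurableSet.iInter fun p => measurable_pi_apply p (.of_discrete)

theorem sieve_eq_sieveBelow {N : ℕ} {g : Residues} {x : ℤ × ℤ}
    (h : ∀ p : Nat.Primes, N ≤ (p : ℕ) → diag x p + g p ≠ 0) : sieve g x = sieveBelow N g x := by
  simp only [sieve, sieveBelow, decide_eq_decide]
  exact ⟨fun H p _ => H p, fun H p => (lt_or_ge (p : ℕ) N).elim (H p) (h p)⟩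

/-- The exceptional set for replacing `sieve` by `sieveBelow N` on `F`. -/
def largePrimeSet (F : Set (ℤ × ℤ)) (N : ℕ) : Set Residues :=
  {g | ∃ x ∈ F, ∃ p : Nat.Primes, N ≤ (p : ℕ) ∧ diag x p + g p = 0}

theorem patch_sieve_eq {ρ : ℝ} {N : ℕ} {g : Residues} (hg : g ∉ largePrimeSet (ball ρ) N) :
    patch ρ (sieve g) 0 = patch ρ (sieveBelow N g) 0 := by
  ext x
  refine and_congr_right fun hx => ?_
  rw [add_zero, sieve_eq_sieveBelow]
  intro p hp h
  exact hg ⟨x, hx, p, hp, h⟩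

/-- For fixed `x`, each prime excludes a single residue, of measure `1 / p²`; sum over `p ≥ N` and
over `F`. -/
theorem haarResidues_largePrimeSet_le {F : Set (ℤ × ℤ)} (hF : F.Finite) (N : ℕ) :
    haarResidues.real (largePrimeSet F N) ≤ F.ncard * invSqTail N := by
  have h1 : ∀ x : ℤ × ℤ, ∀ p : Nat.Primes,
      haarResidues {g | diag x p + g p = 0} = ENNReal.ofReal (1 / ((p : ℕ) : ℝ) ^ 2) := by
    intro x p
    have e : {g : Residues | diag x p + g p = 0} = (fun g => g p) ⁻¹' {-diag x p} := by
      ext g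
      simp [eq_neg_iff_add_eq_zero, add_comm]
    rw [e, ← Measure.map_apply (measurable_pi_apply p) (measurableSet_singleton _), haarResidues,
      Measure.infinitePi_map_eval, uniform_singleton, one_div, ENNReal.ofReal_inv_of_pos
      (by have := p.2.pos; positivity), ENNReal.ofReal_pow (by positivity), ENNReal.ofReal_natCast]
  have h2 : ∀ x : ℤ × ℤ, haarResidues {g | ∃ p : Nat.Primes, N ≤ (p : ℕ) ∧ diag x p + g p = 0} ≤
      ENNReal.ofReal (invSqTail N) := by
    intro x
    calc _ ≤ haarResidues (⋃ n : ℕ, {g | ∃ p : Nat.Primes, (p : ℕ) = n + N ∧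
          diag x p + g p = 0}) := by
          refine measure_mono ?_
          rintro g ⟨p, hp, h⟩
          exact Set.mem_iUnion.2 ⟨p - N, p, by omega, h⟩
      _ ≤ ∑' n : ℕ, haarResidues {g | ∃ p : Nat.Primes, (p : ℕ) = n + N ∧
          diag x p + g p = 0} := measure_iUnion_le _
      _ ≤ ∑' n : ℕ, ENNReal.ofReal (1 / ((n + N : ℕ) : ℝ) ^ 2) := by
          refine ENNReal.tsum_le_tsum fun n => ?_
          -- For composite `n + N` the event is empty, so the sum over primes is bounded by one over
          -- all integers.
          by_cases hn : (n + N).Prime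
          · rw [← h1 x ⟨n + N, hn⟩]
            refine measure_mono ?_
            rintro g ⟨p, hp, h⟩
            obtain rfl : p = ⟨n + N, hn⟩ := Subtype.ext hp
            exact h
          · rw [Set.eq_empty_of_forall_notMem (s := {g | _})]
            · simp
            · rintro g ⟨p, hp, -⟩
              exact hn (hp ▸ p.2)
      _ = _ := (ENNReal.ofReal_tsum_of_nonneg (fun _ => by positivity) (summable_invSq N)).symm
  have h3 : largePrimeSet F N = ⋃ x ∈ hF.toFinset,
      {g | ∃ p : Nat.Primes, N ≤ (p : ℕ) ∧ diag x p + g p = 0} := by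
    ext g
    simp [largePrimeSet]
  have h4 : haarResidues (largePrimeSet F N) ≤ ENNReal.ofReal (F.ncard * invSqTail N) := by
    rw [h3]
    refine (measure_biUnion_finset_le _ _).trans ((Finset.sum_le_sum fun x _ => h2 x).trans ?_)
    rw [Finset.sum_const, ← Set.ncard_eq_toFinset_card F hF, nsmul_eq_mul,
      ENNReal.ofReal_mul (by positivity), ENNReal.ofReal_natCast]
  exact ENNReal.toReal_le_of_le_ofReal (mul_nonneg (by positivity) (invSqTail_nonneg N)) h4

/-- The lattice counterpart of the Haar bound: some `x + t` with `x ∈ ball ρ` is divisible by a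
large prime. The constant `32 = 8 · 2²` comes from `ρ + R ≤ 2R`. -/
theorem ncard_diag_mem_largePrimeSet_le {ρ R : ℝ} (hρ : 0 ≤ ρ) (hR : ρ ≤ R) {N : ℕ} (hN : 0 < N) :
    (({t | diag t ∈ largePrimeSet (ball ρ) N} ∩ ball R).ncard : ℝ) ≤
      (ball ρ).ncard * (1 + 32 * R ^ 2 * invSqTail N) := by
  set B := {t : ℤ × ℤ | ∃ d : ℕ, N ≤ d ∧ (d : ℤ) ∣ t.1 ∧ (d : ℤ) ∣ t.2} ∩ ball (ρ + R) with hB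
  have hBfin : B.Finite := inter_ball_finite _ _
  have hR0 := hρ.trans hR
  have hBc : (B.ncard : ℝ) ≤ 1 + 32 * R ^ 2 * invSqTail N := by
    refine (ncard_large_multiples_le hN (by positivity)).trans ?_
    have : (ρ + R) ^ 2 ≤ (2 * R) ^ 2 := by gcongr; linarith
    have := mul_le_mul_of_nonneg_right this (invSqTail_nonneg N)
    linarith
  have hsub : {t | diag t ∈ largePrimeSet (ball ρ) N} ∩ ball R ⊆
      ⋃ x ∈ (ball_finite ρ).toFinset, (fun u => u - x) '' B := by
    rintro t ⟨⟨x, hx, p, hp, h⟩, ht⟩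
    simp only [Set.mem_iUnion, Set.Finite.mem_toFinset]
    refine ⟨x, hx, x + t, ⟨⟨p, hp, ?_⟩, add_mem_ball hρ hR0 hx ht⟩, by simp⟩
    rw [← Pi.add_apply, ← map_add] at h
    simpa [diag, Prod.ext_iff, ← Int.cast_add, CharP.intCast_eq_zero_iff (ZMod (p : ℕ)) p, -Int.cast_add] using h
  have h1 : ({t | diag t ∈ largePrimeSet (ball ρ) N} ∩ ball R).ncard ≤
      (ball ρ).ncard * B.ncard := by
    refine (Set.ncard_le_ncard hsub ((Set.Finite.biUnion (Finset.finite_toSet _)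
      fun x _ => hBfin.image _))).trans ((Finset.set_ncard_biUnion_le _ _).trans ?_)
    rw [Set.ncard_eq_toFinset_card _ (ball_finite ρ), ← smul_eq_mul]
    exact Finset.sum_le_card_nsmul _ _ _ fun x _ => Set.ncard_image_le hBfin
  calc _ ≤ ((ball ρ).ncard * B.ncard : ℝ) := by exact_mod_cast h1
    _ ≤ _ := by gcongr

/-! ### Existence of patch frequencies -/

/-- Every patch has a frequency in `V`, given by the Haar measure of the residues. -/
theorem hasDensity_patch {ρ : ℝ} (hρ : 0 ≤ ρ) (P : Set (ℤ × ℤ)) :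
    HasDensity {t | patch ρ V t = P} (haarResidues.real {g | patch ρ (sieve g) 0 = P}) := by
  refine HasDensity.of_approx fun ε hε => ?_
  set C : ℝ := ((ball ρ).ncard : ℝ) with hC
  have hC0 : 0 ≤ C := Nat.cast_nonneg _
  have hlim1 : Tendsto (fun N => C * invSqTail N) atTop (𝓝 0) := by
    simpa using tendsto_invSqTail.const_mul C
  have hlim2 : Tendsto (fun N => C * 32 * invSqTail N / Real.pi) atTop (𝓝 0) := by
    simpa using (tendsto_invSqTail.const_mul (C * 32)).div_const Real.pi
  -- `hN1` controls the Haar error; `hN2` spends half of `ε` on the lattice error, leaving half for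
  -- the term `C / (π R²)`, which vanishes only as `R → ∞`.
  obtain ⟨N, hN0, hN1, hN2⟩ := ((eventually_gt_atTop 0).and
    ((hlim1.eventually_lt_const hε).and (hlim2.eventually_lt_const (half_pos hε)))).exists
  set A : Set Residues := {g | patch ρ (sieveBelow N g) 0 = P} with hA
  have hfin : {p : Nat.Primes | (p : ℕ) < N}.Finite :=
    (Set.finite_lt_nat N).preimage Subtype.val_injective.injOn
  refine ⟨{t | diag t ∈ A}, {t | diag t ∈ largePrimeSet (ball ρ) N}, haarResidues.real A,
    hasDensity_of_dependsOn hfin.toFinset ?_, ?_, ?_, ?_⟩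
  · intro g h hgh
    have : sieveBelow N g = sieveBelow N h := by
      funext x
      simp only [sieveBelow, decide_eq_decide]
      exact forall₂_congr fun p hp => by rw [hgh p (by simpa using hp)]
    simp [hA, this]
  · set S : Set Residues := {g | patch ρ (sieve g) 0 = P}
    set L := largePrimeSet (ball ρ) N
    have hL : haarResidues.real L ≤ ε :=
      (haarResidues_largePrimeSet_le (ball_finite ρ) N).trans hN1.le
    have h1 : haarResidues.real A ≤ haarResidues.real S + haarResidues.real L := by
      refine (measureReal_mono ?_).trans (measureReal_union_le S L)
      intro g hg
      by_cases hgL : g ∈ L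
      · exact Or.inr hgL
      · exact Or.inl ((patch_sieve_eq hgL).trans hg)
    have h2 : haarResidues.real S ≤ haarResidues.real A + haarResidues.real L := by
      refine (measureReal_mono ?_).trans (measureReal_union_le A L)
      intro g hg
      by_cases hgL : g ∈ L
      · exact Or.inr hgL
      · exact Or.inl ((patch_sieve_eq hgL).symm.trans hg)
    rw [abs_le]
    constructor <;> linarith
  · intro t ht
    rw [Set.mem_ofPred_eq, Set.mem_ofPred_eq, hA, Set.mem_ofPred_eq, ← patch_sieve_eq ht,
      patch_sieve_diag]
  · have hlim : Tendsto (fun R : ℝ => C / (Real.pi * R ^ 2)) atTop (𝓝 0) :=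
      tendsto_const_nhds.div_atTop
        ((tendsto_pow_atTop two_ne_zero).const_mul_atTop Real.pi_pos)
    filter_upwards [hlim.eventually_lt_const (half_pos hε), eventually_ge_atTop ρ,
      eventually_gt_atTop 0] with R h1 h2 h3
    have hpi := Real.pi_pos
    calc _ ≤ C * (1 + 32 * R ^ 2 * invSqTail N) / (Real.pi * R ^ 2) := by
          gcongr
          exact ncard_diag_mem_largePrimeSet_le hρ h2 hN0
      _ = C / (Real.pi * R ^ 2) + C * 32 * invSqTail N / Real.pi := by
          field_simp
      _ ≤ ε := by linarith

/-! ### The hull in terms of patches, and the measure on it -/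

theorem measurableSet_patch_eq (ρ : ℝ) (P : Set (ℤ × ℤ)) :
    MeasurableSet {X : Config | patch ρ X 0 = P} := by
  have : {X : Config | patch ρ X 0 = P} =
      ⋂ x : ℤ × ℤ, {X | (x ∈ ball ρ ∧ X x = true) ↔ x ∈ P} := by
    ext X
    simp [patch, Set.ext_iff]
  rw [this]
  refine MeasurableSet.iInter fun x => ?_
  exact (measurable_pi_apply x : Measurable fun X : Config => X x)
    (t := {b | (x ∈ ball ρ ∧ b = true) ↔ x ∈ P}) (.of_discrete)

theorem patch_mem_patches {X : Config} (hX : X ∈ hull) (ρ : ℝ) : patch ρ X 0 ∈ patches ρ := by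
  have hopen : IsOpen (Set.pi (ball ρ) fun x => ({X x} : Set Bool)) :=
    isOpen_set_pi (ball_finite ρ) fun _ _ => isOpen_discrete _
  obtain ⟨_, hY, t, rfl⟩ := mem_closure_iff.1 hX _ hopen fun x _ => rfl
  refine ⟨-t, ?_⟩
  ext x
  refine and_congr_right fun hx => ?_
  have : V (x - t) = X x := hY x hx
  rw [add_zero, ← this, sub_eq_add_neg]

theorem mem_hull_of_patch {X : Config} (h : ∀ n : ℕ, 0 < n → patch n X 0 ∈ patches n) :
    X ∈ hull := by
  refine mem_closure_iff.2 fun U hU hX => ?_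
  obtain ⟨s, u, hu, hsub⟩ := isOpen_pi_iff.1 hU X hX
  choose m hm0 hm using exists_mem_ball
  set n := s.sup m + 1
  obtain ⟨t, ht⟩ := h n (by omega)
  refine ⟨translate (-t) V, hsub fun x hx => ?_, -t, rfl⟩
  have hxn : x ∈ ball n := by
    refine ball_mono (Nat.cast_nonneg _) (Nat.cast_le.2 ?_) (hm x)
    exact (Finset.le_sup (f := m) hx).trans (Nat.le_succ _)
  have h1 : x ∈ patch n V t ↔ x ∈ patch n X 0 := by rw [ht]
  have h2 : V (x + t) = X x := by
    rw [Bool.eq_iff_iff]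
    simpa [patch, hxn] using h1
  change V (x - -t) ∈ u x
  rw [sub_neg_eq_add, h2]
  exact (hu x hx).2

/-- A patch that never occurs in `V` has density zero, hence Haar measure zero by
`hasDensity_patch`. Only finitely many candidates exist for each integer radius, and integer radii
detect the hull. -/
theorem ae_sieve_mem_hull : ∀ᵐ g ∂haarResidues, sieve g ∈ hull := by
  have key : ∀ n : ℕ, ∀ᵐ g ∂haarResidues, patch n (sieve g) 0 ∈ patches n := by
    intro n
    have hfin : {P : Set (ℤ × ℤ) | P ⊆ ball n ∧ P ∉ patches n}.Finite :=
      (ball_finite n).finite_subsets.subset fun P hP => hP.1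
    have h0 : ∀ P ∈ {P : Set (ℤ × ℤ) | P ⊆ ball n ∧ P ∉ patches n},
        ∀ᵐ g ∂haarResidues, patch n (sieve g) 0 ≠ P := by
      rintro P ⟨-, hP⟩
      have h1 := hasDensity_patch (Nat.cast_nonneg n) P
      have h2 : {t | patch n V t = P} = ∅ :=
        Set.eq_empty_of_forall_notMem fun t ht => hP ⟨t, ht⟩
      rw [h2] at h1
      have h3 := h1.unique hasDensity_empty
      rw [measureReal_eq_zero_iff] at h3
      rw [ae_iff]
      simpa using h3
    filter_upwards [(ae_ball_iff hfin.countable).2 h0] with g hg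
    by_contra hcon
    exact hg _ ⟨fun x hx => hx.1, hcon⟩ rfl
  filter_upwards [ae_all_iff.2 key] with g hg
  exact mem_hull_of_patch fun n _ => hg n

theorem measurableSet_hull : MeasurableSet hull := isClosed_closure.measurableSet

/-- The patch frequency measure: the image of the Haar measure under `sieve`. -/
noncomputable def patchFrequencyMeasure : Measure hull :=
  (haarResidues.map sieve).comap Subtype.val

theorem patchFrequencyMeasure_apply {E : Set hull} (hE : MeasurableSet E) :
    patchFrequencyMeasure E = haarResidues (sieve ⁻¹' (Subtype.val '' E)) := by
  have he := MeasurableEmbedding.subtype_coe measurableSet_hull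
  rw [patchFrequencyMeasure, he.comap_apply,
    Measure.map_apply measurable_sieve (he.measurableSet_image.2 hE)]

theorem patchFrequencyMeasure_preimage {A : Set Config} (hA : MeasurableSet A) :
    patchFrequencyMeasure (Subtype.val ⁻¹' A) = haarResidues (sieve ⁻¹' A) := by
  rw [patchFrequencyMeasure_apply (measurable_subtype_coe hA)]
  refine measure_congr ?_
  filter_upwards [ae_sieve_mem_hull] with g hg
  refine propext ⟨?_, fun h => ⟨⟨sieve g, hg⟩, h, rfl⟩⟩
  rintro ⟨X, hX, hXg⟩
  change sieve g ∈ A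
  rw [← hXg]
  exact hX

instance : IsProbabilityMeasure patchFrequencyMeasure := by
  constructor
  have h := patchFrequencyMeasure_preimage MeasurableSet.univ
  simpa using h

theorem isPatchFrequencyMeasure : IsPatchFrequencyMeasure patchFrequencyMeasure where
  isProbabilityMeasure := inferInstance
  hasDensity ρ hρ P _ := by
    have h := patchFrequencyMeasure_preimage (measurableSet_patch_eq ρ P)
    have h' : patchFrequencyMeasure.real (patchCylinder ρ P) =
        haarResidues.real {g | patch ρ (sieve g) 0 = P} := congrArg ENNReal.toReal h
    rw [h']
    exact hasDensity_patch hρ.le P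

theorem measurableSet_patchCylinder (ρ : ℝ) (P : Set (ℤ × ℤ)) :
    MeasurableSet (patchCylinder ρ P) :=
  measurable_subtype_coe (measurableSet_patch_eq ρ P)

/-! ### Uniqueness -/

/-- The cylinder sets of the patches of `V`. -/
def cylinders : Set (Set hull) := {E | ∃ ρ : ℝ, 0 < ρ ∧ ∃ P ∈ patches ρ, E = patchCylinder ρ P}

theorem patchCylinder_subset_of_mem {ρ r : ℝ} (hρ : 0 ≤ ρ) (h : ρ ≤ r) {P Q : Set (ℤ × ℤ)}
    {X : hull} (hX : X ∈ patchCylinder ρ P) (hX' : X ∈ patchCylinder r Q) :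
    patchCylinder r Q ⊆ patchCylinder ρ P := by
  intro Y hY
  have key : ∀ Z : hull, patch ρ Z.1 0 = patch r Z.1 0 ∩ ball ρ := by
    intro Z
    ext x
    exact ⟨fun hx => ⟨⟨ball_mono hρ h hx.1, hx.2⟩, hx.1⟩, fun hx => ⟨hx.2, hx.1.2⟩⟩
  have e1 : patch ρ X.1 0 = P := hX
  have e2 : patch r X.1 0 = Q := hX'
  have e3 : patch r Y.1 0 = Q := hY
  change patch ρ Y.1 0 = P
  rw [key, e3, ← e2, ← key, e1]

/-- A patch determines all smaller ones, so two cylinders that meet are nested. -/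
theorem isPiSystem_cylinders : IsPiSystem cylinders := by
  rintro _ ⟨ρ, hρ, P, hP, rfl⟩ _ ⟨r, hr, Q, hQ, rfl⟩ ⟨X, hX, hX'⟩
  rcases le_total ρ r with h | h
  · rw [Set.inter_eq_right.2 (patchCylinder_subset_of_mem hρ.le h hX hX')]
    exact ⟨r, hr, Q, hQ, rfl⟩
  · rw [Set.inter_eq_left.2 (patchCylinder_subset_of_mem hr.le h hX' hX)]
    exact ⟨ρ, hρ, P, hP, rfl⟩

/-- The event that a given point is occupied is a finite union of cylinders, over the patches of a
disc containing that point. -/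
theorem generateFrom_cylinders :
    (inferInstance : MeasurableSpace hull) = MeasurableSpace.generateFrom cylinders := by
  refine le_antisymm ?_ (MeasurableSpace.generateFrom_le ?_)
  · have hval : @Measurable hull Config (MeasurableSpace.generateFrom cylinders) _
        Subtype.val := by
      refine @measurable_pi_lambda _ _ _ (MeasurableSpace.generateFrom cylinders) _ _ fun x => ?_
      refine @measurable_to_bool _ (MeasurableSpace.generateFrom cylinders) _ ?_
      obtain ⟨n, hn, hx⟩ := exists_mem_ball x
      have hfin : {P : Set (ℤ × ℤ) | P ∈ patches n ∧ x ∈ P}.Finite := by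
        refine (ball_finite n).finite_subsets.subset ?_
        rintro _ ⟨⟨t, rfl⟩, -⟩ y hy
        exact hy.1
      have e : (fun X : hull => X.1 x) ⁻¹' {true} =
          ⋃ P ∈ {P : Set (ℤ × ℤ) | P ∈ patches n ∧ x ∈ P}, patchCylinder n P := by
        ext X
        simp only [Set.mem_preimage, Set.mem_singleton_iff, Set.mem_iUnion, exists_prop]
        constructor
        · intro h
          exact ⟨patch n X.1 0, ⟨patch_mem_patches X.2 n, hx, by simpa using h⟩, rfl⟩
        · rintro ⟨P, ⟨-, hxP⟩, hX⟩
          have e : patch n X.1 0 = P := hX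
          rw [← e] at hxP
          simpa using hxP.2
      rw [e]
      refine @MeasurableSet.biUnion _ _ (MeasurableSpace.generateFrom cylinders) _ _
        hfin.countable fun P hP => MeasurableSpace.measurableSet_generateFrom ?_
      exact ⟨n, Nat.cast_pos.2 hn, P, hP.1, rfl⟩
    exact hval.comap_le
  · rintro _ ⟨ρ, -, P, -, rfl⟩
    exact measurableSet_patchCylinder ρ P

theorem IsPatchFrequencyMeasure.unique {ν ν' : Measure hull} (h : IsPatchFrequencyMeasure ν)
    (h' : IsPatchFrequencyMeasure ν') : ν = ν' := by
  have := h.isProbabilityMeasure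
  have := h'.isProbabilityMeasure
  refine ext_of_generate_finite cylinders generateFrom_cylinders isPiSystem_cylinders ?_ (by simp)
  rintro _ ⟨ρ, hρ, P, hP, rfl⟩
  exact (measureReal_eq_measureReal_iff).1
    ((h.hasDensity ρ hρ P hP).unique (h'.hasDensity ρ hρ P hP))

/-! ### Invariance and ergodicity -/

theorem preimage_sieve_vadd (t : ℤ × ℤ) (E : Set hull) :
    sieve ⁻¹' (Subtype.val '' ((t +ᵥ ·) ⁻¹' E)) =
      (fun g => -diag t + g) ⁻¹' (sieve ⁻¹' (Subtype.val '' E)) := by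
  ext g
  rw [Set.mem_preimage, Set.mem_preimage, Set.mem_preimage, neg_add_eq_sub, sieve_sub_diag]
  constructor
  · rintro ⟨X, hX, hXg⟩
    exact ⟨t +ᵥ X, hX, congrArg (translate t) hXg⟩
  · rintro ⟨Y, hY, hYg⟩
    have hg : sieve g = translate (-t) Y.1 := by
      rw [hYg, translate_translate, neg_add_cancel]
      exact funext fun x => congrArg (sieve g) (sub_zero x).symm
    refine ⟨⟨sieve g, hg ▸ translate_mem_hull _ Y.2⟩, ?_, rfl⟩
    have hYE : t +ᵥ (⟨sieve g, hg ▸ translate_mem_hull _ Y.2⟩ : hull) = Y := Subtype.ext hYg.symm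
    rw [Set.mem_preimage, hYE]
    exact hY

theorem measurable_vadd_hull (t : ℤ × ℤ) : Measurable fun X : hull => t +ᵥ X :=
  ((measurable_pi_lambda _ fun x => measurable_pi_apply (x - t)).comp
    measurable_subtype_coe).subtype_mk

theorem sieve_preimage_ae_eq {A B : Set hull} (hA : MeasurableSet A) (hB : MeasurableSet B)
    (h : A =ᵐ[patchFrequencyMeasure] B) :
    sieve ⁻¹' (Subtype.val '' A) =ᵐ[haarResidues] sieve ⁻¹' (Subtype.val '' B) := by
  rw [ae_eq_set] at h ⊢
  rwa [patchFrequencyMeasure_apply (hA.diff hB), patchFrequencyMeasure_apply (hB.diff hA),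
    Set.image_sdiff Subtype.val_injective, Set.image_sdiff Subtype.val_injective,
    Set.preimage_sdiff, Set.preimage_sdiff] at h

theorem ergodicVAdd_patchFrequencyMeasure :
    ErgodicVAdd (ℤ × ℤ) hull patchFrequencyMeasure where
  measure_preimage_vadd t E hE := by
    rw [patchFrequencyMeasure_apply (measurable_vadd_hull t hE), preimage_sieve_vadd,
      measure_preimage_add, patchFrequencyMeasure_apply hE]
  aeconst_of_forall_preimage_vadd_ae_eq {E} hE h := by
    have he := MeasurableEmbedding.subtype_coe measurableSet_hull
    have hE' : MeasurableSet (sieve ⁻¹' (Subtype.val '' E)) :=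
      measurable_sieve (he.measurableSet_image.2 hE)
    have hconst : EventuallyConst (sieve ⁻¹' (Subtype.val '' E)) (ae haarResidues) := by
      -- A set almost invariant under a dense set of rotations is null or conull for Haar measure.
      refine aeconst_of_dense_setOfPred_preimage_vadd_ae (M := Residues) hE'.nullMeasurableSet
        (denseRange_diag.mono ?_)
      rintro _ ⟨t, rfl⟩
      -- The sign compensates for translation by `t` acting as rotation by `-diag t`.
      have ht := sieve_preimage_ae_eq (measurable_vadd_hull (-t) hE) hE (h (-t))
      rw [preimage_sieve_vadd, map_neg, neg_neg] at ht
      exact ht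
    rw [eventuallyConst_set'] at hconst ⊢
    refine hconst.imp (fun h0 => ?_) fun h1 => ?_
    · rw [ae_eq_empty, patchFrequencyMeasure_apply hE, measure_congr h0, measure_empty]
    · rw [ae_eq_univ, prob_compl_eq_zero_iff hE, patchFrequencyMeasure_apply hE, measure_congr h1,
        measure_univ]

end VisiblePoints

/-- There is exactly one Borel probability measure on the hull of the visible points that is given
on cylinder sets by the patch frequencies; it is invariant and ergodic for the translation action
of `ℤ²`. -/
theorem mainTheorem2 :
    ∃ ν : MeasureTheory.Measure VisiblePoints.hull,
      VisiblePoints.IsPatchFrequencyMeasure ν ∧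
      (∀ ν' : MeasureTheory.Measure VisiblePoints.hull,
        VisiblePoints.IsPatchFrequencyMeasure ν' → ν' = ν) ∧
      ErgodicVAdd (ℤ × ℤ) VisiblePoints.hull ν :=
  ⟨VisiblePoints.patchFrequencyMeasure, VisiblePoints.isPatchFrequencyMeasure,
    fun _ h => h.unique VisiblePoints.isPatchFrequencyMeasure,
    VisiblePoints.ergodicVAdd_patchFrequencyMeasure⟩
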